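/- Let $\gamma>0$ and $k(x,y)=\exp(-\gamma\|x-y\|^2)$ be the Gaussian kernel on $\mathbb R^m$. For matrices $A,B$ with $m$ rows let $K_{A,B}$ be the kernel matrix with entries $k(A_{:,i},B_{:,j})$. For $A\in\mathbb R^{m\times a}$ and $B\in\mathbb R^{m\times b}$ with $a,b\ge 2$ let $$\mathrm{MMD}(A,B)=\frac{1}{a(a-1)}\sum_{i=1}^{a}\sum_{j\ne i}k(A_{:,i},A_{:,j})-\frac{2}{ab}\sum_{i=1}^{a}\sum_{j=1}^{b}k(A_{:,i},B_{:,j})+\frac{1}{b(b-1)}\sum_{i=1}^{b}\sum_{j\neq i}k(B_{:,i},B_{:,j}).$$ For a real $N\times N$ matrix $H$ with singular values $\sigma_1\ge\dots\ge\sigma_N$ let $\mathrm{Cond}(H)=\sigma_1/\sigma_N\in[1,\infty]$, with the value $\infty$ if $\sigma_N=0$. A best rank-$k$ approximation of $H$ is a truncated singular value decomposition $\sum_{i\le k}\sigma_iu_iv_i^T$, where $H=\sum_{i\le N}\sigma_iu_iv_i^T$ is any singular value decomposition of $H$ (so it is $H$ itself if $k\ge N$). **Theorem (Error bound of Nyström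 approximation with FedDL having gradient perturbation).** Let $X=[X_1,\dots,X_P]$ with $X_p\in\mathbb R^{m\times n_p}$ and $\sum_{p}n_p=n_x\ge 2$ be the clients' data, let $Y,E\in\mathbb R^{m\times n_y}$ with $n_y\ge2$, and let $\tilde Y=Y+E$ be the noisy landmarks; $E$ is an arbitrary matrix, so the bounds hold for every realization of random (e.g. Gaussian) noise. Let $0\le k\le n_x+n_y$ be an integer, let $W_k$ be any best rank-$k$ approximation of $W=K_{\tilde Y,\tilde Y}$, let $W_k^\dagger$ be its Moore–Penrose inverse, and let $$\widehat H_{X,X|\tilde Y}=K_{X,\tilde Y}\,W_k^\dagger\,K_{X,\tilde Y}^T .$$ Let $\tilde X_a=[\tilde Y,X]\in\mathbb R^{m\times(n_x+n_y)}$ be the augmented matrix. Then $$\big\|\widehat H_{X,X|\tilde Y}-K_{X,X}\big\|_2\le \mathrm{Cond}(K_{\tilde X_a,\tilde X_a})\left(\frac{|\mathrm{MMD}(X,\tilde Y)|}{n_x+n_y}+1\right)+2n_x$$ and $$\big\|\widehat H_{X,X|\tilde Y}-K_{X,X}\big\|_F\le \sqrt{n_x+n_y-k}\;\mathrm{Cond}(K_{\tilde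 X_a,\tilde X_a})\left(\frac{|\mathrm{MMD}(X,\tilde Y)|}{n_x+n_y}+1\right)+2k^{1/4}n_x\sqrt{1+\frac{n_y}{n_x}},$$ where $\|\cdot\|_2$ is the spectral norm, $\|\cdot\|_F$ the Frobenius norm, and $0\cdot\infty=0$. -/

import Mathlib

open scoped ENNReal Matrix

noncomputable section

/-- The matrix `[X₁, …, X_P]` whose columns are those of the client blocks `X p`; the column index
`⟨p, i⟩` is the `i`-th column of client `p`. -/
def concatClients {m P : ℕ} {n : Fin P → ℕ} (X : (p : Fin P) → Matrix (Fin m) (Fin (n p)) ℝ) :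
    Matrix (Fin m) ((p : Fin P) × Fin (n p)) ℝ :=
  Matrix.of fun l c => X c.1 l c.2

/-- The Gaussian kernel `k(x, y) = exp (-γ ‖x - y‖²)`, with the Euclidean norm on `ℝᵐ`. -/
def gaussianKernel {m : ℕ} (γ : ℝ) (x y : Fin m → ℝ) : ℝ :=
  Real.exp (-γ * ∑ l, (x l - y l) ^ 2)

/-- The kernel matrix `K_{X,Y}` of the columns of `X` against the columns of `Y`. -/
def kernelMatrix {m : ℕ} {ι κ : Type*} (γ : ℝ) (X : Matrix (Fin m) ι ℝ)
    (Y : Matrix (Fin m) κ ℝ) : Matrix ι κ ℝ :=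
  Matrix.of fun i j => gaussianKernel γ (X.col i) (Y.col j)

/-- The (unbiased, sample) maximum mean discrepancy `MMD(X, Y)` for the Gaussian kernel. It is
meaningful when both `X` and `Y` have at least two columns. -/
def mmd {m : ℕ} {ι κ : Type*} [Fintype ι] [DecidableEq ι] [Fintype κ] [DecidableEq κ] (γ : ℝ)
    (X : Matrix (Fin m) ι ℝ) (Y : Matrix (Fin m) κ ℝ) : ℝ :=
  1 / ((Fintype.card ι : ℝ) * ((Fintype.card ι : ℝ) - 1)) *
      ∑ i, ∑ j ∈ Finset.univ.erase i, gaussianKernel γ (X.col i) (X.col j)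
    - 2 / ((Fintype.card ι : ℝ) * (Fintype.card κ : ℝ)) *
      ∑ i, ∑ j, gaussianKernel γ (X.col i) (Y.col j)
    + 1 / ((Fintype.card κ : ℝ) * ((Fintype.card κ : ℝ) - 1)) *
      ∑ i, ∑ j ∈ Finset.univ.erase i, gaussianKernel γ (Y.col i) (Y.col j)

/-- The spectral norm `‖A‖₂`: the operator norm for the Euclidean norm. -/
def matSpectralNorm {ι : Type*} [Fintype ι] [DecidableEq ι] (A : Matrix ι ι ℝ) : ℝ :=
  ‖Matrix.toEuclideanCLM (𝕜 := ℝ) A‖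

/-- The Frobenius norm `‖A‖_F`. -/
def matFrobeniusNorm {ι : Type*} [Fintype ι] (A : Matrix ι ι ℝ) : ℝ :=
  Real.sqrt (∑ i, ∑ j, A i j ^ 2)

/-- The spectral condition number `σ₁ / σ_N` of an `N × N` matrix, which is `∞` for a singular
matrix. (Mathlib's singular values are in decreasing order and indexed from `0`.) -/
def condNumber {ι : Type*} [Fintype ι] [DecidableEq ι] (A : Matrix ι ι ℝ) : ℝ≥0∞ :=
  if (Matrix.toEuclideanLin A).singularValues (Fintype.card ι - 1) = 0 then ∞
  else ENNReal.ofReal ((Matrix.toEuclideanLin A).singularValues 0 /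
    (Matrix.toEuclideanLin A).singularValues (Fintype.card ι - 1))

/-- `M` is a best rank-`k` approximation of the square matrix `A`, i.e. a truncated singular value
decomposition: `A = ∑ᵢ σᵢ uᵢ vᵢᵀ` with orthonormal `uᵢ`, orthonormal `vᵢ` and
`σ₁ ≥ σ₂ ≥ ⋯ ≥ 0`, and `M = ∑_{i ≤ k} σᵢ uᵢ vᵢᵀ`. If `σ_k = σ_{k+1}` there are several such `M`,
and every one of them satisfies the predicate. -/
def IsBestRankApprox {n : ℕ} (k : ℕ) (A M : Matrix (Fin n) (Fin n) ℝ) : Prop :=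
  ∃ U ∈ Matrix.orthogonalGroup (Fin n) ℝ, ∃ V ∈ Matrix.orthogonalGroup (Fin n) ℝ,
    ∃ σ : Fin n → ℝ, Antitone σ ∧ (∀ i, 0 ≤ σ i) ∧
      A = U * Matrix.diagonal σ * Vᵀ ∧
      M = U * Matrix.diagonal (fun i : Fin n => if (i : ℕ) < k then σ i else 0) * Vᵀ

/-- `G` is the Moore-Penrose inverse of the real matrix `A`: the four Penrose equations. -/
def IsMoorePenroseInverse {ι κ : Type*} [Fintype ι] [Fintype κ] (A : Matrix ι κ ℝ)
    (G : Matrix κ ι ℝ) : Prop :=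
  A * G * A = A ∧ G * A * G = G ∧ (A * G)ᵀ = A * G ∧ (G * A)ᵀ = G * A

/-- The rank-`k` Nyström estimate `B W_k† Bᵀ` of `K_{X,X}` from the landmarks `Y`, with
`B = K_{X,Y}`, as a function of the matrix `Wd` used for `W_k†`. -/
def nystromEstimate {m : ℕ} {ι κ : Type*} [Fintype κ] (γ : ℝ) (X : Matrix (Fin m) ι ℝ)
    (Y : Matrix (Fin m) κ ℝ) (Wd : Matrix κ κ ℝ) : Matrix ι ι ℝ :=
  kernelMatrix γ X Y * Wd * (kernelMatrix γ X Y)ᵀ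

end

/-! ### Positive semidefiniteness of the Gaussian kernel matrix -/

/-! The Nyström estimate `Ĥ` satisfies `0 ≤ Ĥ ≤ K_{X,X}` in the Loewner order: the augmented kernel
matrix is positive semidefinite, and `K_{X,X} - Ĥ` is a congruence of it, as for a Schur complement
(`posSemidef_mul_pinv_mul_transpose`). Hence the error is positive semidefinite with trace at most
`tr K_{X,X} = n_x`, and both its norms are at most `n_x`. The additive terms `2 n_x` and, for `k ≥
1`, `2 k^{1/4} n_x √(1 + n_y/n_x)` already dominate this.

Only the Frobenius bound with `k = 0` needs the condition number. There `Ĥ = 0`, and with `N = n_x +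
n_y` the norm of `K_{X,X}` is at most that of the augmented matrix, hence at most `√N σ₁`. That
matrix has trace `N`, so `σ_N ≤ 1` and `σ₁ ≤ Cond`. The MMD enters only through a factor that is at
least `1`. -/

theorem Matrix.PosSemidef.map_pow {ι : Type*} [Fintype ι] {A : Matrix ι ι ℝ}
    (hA : A.PosSemidef) (r : ℕ) : (Matrix.of fun i j => A i j ^ r).PosSemidef := by
  induction r with
  | zero =>
    convert Matrix.posSemidef_vecMulVec_self_star (fun _ : ι => (1 : ℝ)) using 1
    ext i j
    simp [Matrix.vecMulVec_apply]
  | succ r ih =>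
    have h : (Matrix.of fun i j => A i j ^ (r + 1)) =
        Matrix.hadamard (Matrix.of fun i j => A i j ^ r) A := by
      ext i j
      simp [Matrix.hadamard_apply, pow_succ]
    rw [h]
    exact ih.hadamard hA

/-- The exponential series has nonnegative coefficients, and entrywise powers stay positive
semidefinite by the Schur product theorem. -/
theorem Matrix.PosSemidef.map_exp {ι : Type*} [Fintype ι] {A : Matrix ι ι ℝ}
    (hA : A.PosSemidef) : (Matrix.of fun i j => Real.exp (A i j)).PosSemidef := by
  refine Matrix.PosSemidef.of_dotProduct_mulVec_nonneg ?_ fun x => ?_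
  · ext i j
    have := hA.isHermitian.apply i j
    simp only [star_trivial] at this
    simp [this]
  · have hs : HasSum (fun r : ℕ => ∑ i, ∑ j, x i * (A i j ^ r / (r.factorial : ℝ) * x j))
        (∑ i, ∑ j, x i * (Real.exp (A i j) * x j)) := by
      refine hasSum_sum fun i _ => hasSum_sum fun j _ => ((HasSum.mul_right _ ?_).mul_left _)
      rw [Real.exp_eq_exp_ℝ]
      exact NormedSpace.expSeries_div_hasSum_exp (A i j)
    have he : star x ⬝ᵥ ((Matrix.of fun i j => Real.exp (A i j)) *ᵥ x) =
        ∑ i, ∑ j, x i * (Real.exp (A i j) * x j) := by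
      simp [dotProduct, Matrix.mulVec, Finset.mul_sum]
    rw [he]
    refine hs.nonneg fun r => ?_
    have h := (hA.map_pow r).dotProduct_mulVec_nonneg x
    have h2 : ∑ i, ∑ j, x i * (A i j ^ r / (r.factorial : ℝ) * x j) =
        (star x ⬝ᵥ ((Matrix.of fun i j => A i j ^ r) *ᵥ x)) / (r.factorial : ℝ) := by
      simp only [dotProduct, Matrix.mulVec, Finset.mul_sum, Finset.sum_div, Matrix.of_apply,
        star_trivial]
      exact Finset.sum_congr rfl fun i _ => Finset.sum_congr rfl fun j _ => by ring
    rw [h2]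
    positivity

theorem gaussianKernel_comm {m : ℕ} (γ : ℝ) (x y : Fin m → ℝ) :
    gaussianKernel γ x y = gaussianKernel γ y x := by
  simp only [gaussianKernel, sub_sq_comm]

theorem gaussianKernel_self {m : ℕ} (γ : ℝ) (x : Fin m → ℝ) : gaussianKernel γ x x = 1 := by
  simp [gaussianKernel]

/-- Expanding the square, `k(x,y) = e^{-γ‖x‖²} e^{2γ⟨x,y⟩} e^{-γ‖y‖²}`: a diagonal congruence of the
entrywise exponential of a Gram matrix. -/
theorem posSemidef_kernelMatrix {m : ℕ} {ι : Type*} [Fintype ι] [DecidableEq ι] {γ : ℝ}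
    (hγ : 0 ≤ γ) (X : Matrix (Fin m) ι ℝ) : (kernelMatrix γ X X).PosSemidef := by
  have hG : ((2 * γ) • (Xᵀ * X)).PosSemidef := by
    have := Matrix.posSemidef_conjTranspose_mul_self X
    rw [Matrix.conjTranspose_eq_transpose_of_trivial] at this
    exact this.smul (by positivity)
  have h := hG.map_exp.conjTranspose_mul_mul_same
    (Matrix.diagonal fun i => Real.exp (-γ * ∑ l, X l i ^ 2))
  convert h using 1
  ext i j
  rw [Matrix.conjTranspose_eq_transpose_of_trivial, Matrix.diagonal_transpose,
    Matrix.mul_diagonal, Matrix.diagonal_mul]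
  simp only [kernelMatrix, gaussianKernel, Matrix.of_apply, Matrix.smul_apply, Matrix.mul_apply,
    Matrix.transpose_apply, smul_eq_mul, ← Real.exp_add, Matrix.col_apply]
  congr 1
  simp only [Finset.mul_sum, ← Finset.sum_add_distrib]
  exact Finset.sum_congr rfl fun l _ => by ring

theorem trace_kernelMatrix_self {m : ℕ} {ι : Type*} [Fintype ι] (γ : ℝ)
    (X : Matrix (Fin m) ι ℝ) : (kernelMatrix γ X X).trace = Fintype.card ι := by
  simp [Matrix.trace, kernelMatrix, gaussianKernel_self]

theorem kernelMatrix_fromCols {m : ℕ} {ι κ : Type*} (γ : ℝ) (Y : Matrix (Fin m) κ ℝ)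
    (X : Matrix (Fin m) ι ℝ) :
    kernelMatrix γ (Matrix.fromCols Y X) (Matrix.fromCols Y X) =
      Matrix.fromBlocks (kernelMatrix γ Y Y) (kernelMatrix γ X Y)ᵀ
        (kernelMatrix γ X Y) (kernelMatrix γ X X) := by
  ext (i | i) (j | j)
  · rfl
  · exact gaussianKernel_comm ..
  · rfl
  · rfl

/-! ### Truncated singular value decompositions and Moore-Penrose inverses -/

/-- For positive semidefinite `A` the two orthogonal factors may differ only on the kernel, so every
truncated SVD is a truncated spectral decomposition. -/
theorem IsBestRankApprox.posSemidef_and_mul_eq {n k : ℕ} {A M : Matrix (Fin n) (Fin n) ℝ}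
    (hA : A.PosSemidef) (h : IsBestRankApprox k A M) : M.PosSemidef ∧ A * M = M * M := by
  obtain ⟨U, hU, V, hV, σ, -, hσ, rfl, rfl⟩ := h
  set τ : Fin n → ℝ := fun i => if (i : ℕ) < k then σ i else 0 with hτ
  have hUU : Uᵀ * U = 1 := (Matrix.mem_orthogonalGroup_iff' (Fin n) ℝ).mp hU
  have hVV : Vᵀ * V = 1 := (Matrix.mem_orthogonalGroup_iff' (Fin n) ℝ).mp hV
  have conj_psd : ∀ d : Fin n → ℝ, (∀ i, 0 ≤ d i) →
      (U * Matrix.diagonal d * Uᵀ).PosSemidef := fun d hd => by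
    have := (Matrix.PosSemidef.diagonal (show 0 ≤ d from hd)).mul_mul_conjTranspose_same U
    rwa [Matrix.conjTranspose_eq_transpose_of_trivial] at this
  have hsymm : (U * Matrix.diagonal σ * Vᵀ)ᵀ = U * Matrix.diagonal σ * Vᵀ := by
    rw [← Matrix.conjTranspose_eq_transpose_of_trivial]; exact hA.isHermitian
  -- Both sides are positive semidefinite with the same square, since `A² = A Aᵀ = U Σ² Uᵀ`;
  -- positive square roots are unique.
  have hsq : U * Matrix.diagonal σ * Vᵀ = U * Matrix.diagonal σ * Uᵀ := by
    open scoped MatrixOrder Matrix.Norms.L2Operator in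
    refine (CFC.sq_eq_sq_iff _ _ hA.nonneg (conj_psd σ hσ).nonneg).mp ?_
    rw [sq, sq]
    nth_rewrite 2 [← hsymm]
    simp only [Matrix.transpose_mul, Matrix.transpose_transpose, Matrix.diagonal_transpose,
      Matrix.mul_assoc]
    rw [← Matrix.mul_assoc Vᵀ V, ← Matrix.mul_assoc Uᵀ U, hUU, hVV]
  have hrow : Matrix.diagonal σ * Vᵀ = Matrix.diagonal σ * Uᵀ := by
    have := congrArg (Uᵀ * ·) hsq
    simpa only [← Matrix.mul_assoc, hUU, Matrix.one_mul] using this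
  have hτσ : Matrix.diagonal τ =
      Matrix.diagonal (fun i : Fin n => if (i : ℕ) < k then (1 : ℝ) else 0) *
        Matrix.diagonal σ := by
    rw [Matrix.diagonal_mul_diagonal]
    congr 1
    ext i
    simp [hτ]
  have hM : U * Matrix.diagonal τ * Vᵀ = U * Matrix.diagonal τ * Uᵀ := by
    rw [hτσ]
    simp only [Matrix.mul_assoc, hrow]
  rw [hM, hsq]
  refine ⟨conj_psd τ fun i => by simp only [hτ]; split_ifs <;> simp [hσ], ?_⟩
  have key : ∀ d : Fin n → ℝ, U * Matrix.diagonal d * Uᵀ * (U * Matrix.diagonal τ * Uᵀ) =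
      U * Matrix.diagonal (fun i => d i * τ i) * Uᵀ := fun d => by
    rw [← Matrix.diagonal_mul_diagonal]
    simp only [Matrix.mul_assoc]
    rw [← Matrix.mul_assoc Uᵀ U, hUU, Matrix.one_mul]
  rw [key, key]
  congr 3
  ext i
  simp only [hτ]
  split_ifs <;> simp

theorem IsMoorePenroseInverse.unique {ι κ : Type*} [Fintype ι] [Fintype κ] {A : Matrix ι κ ℝ}
    {G H : Matrix κ ι ℝ} (hG : IsMoorePenroseInverse A G) (hH : IsMoorePenroseInverse A H) :
    G = H := by
  obtain ⟨g1, g2, g3, g4⟩ := hG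
  obtain ⟨h1, h2, h3, h4⟩ := hH
  have e1 : A * G = A * H := by
    calc A * G = (A * H) * (A * G) := by rw [← Matrix.mul_assoc, h1]
      _ = ((A * G) * (A * H))ᵀ := by rw [Matrix.transpose_mul, g3, h3]
      _ = A * H := by rw [← Matrix.mul_assoc, g1, h3]
  have e2 : G * A = H * A := by
    calc G * A = (G * A) * (H * A) := by rw [Matrix.mul_assoc, ← Matrix.mul_assoc A, h1]
      _ = ((H * A) * (G * A))ᵀ := by rw [Matrix.transpose_mul, g4, h4]
      _ = H * A := by rw [Matrix.mul_assoc, ← Matrix.mul_assoc A, g1, h4]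
  calc G = G * (A * G) := by rw [← Matrix.mul_assoc, g2]
    _ = H * A * H := by rw [e1, ← Matrix.mul_assoc, e2]
    _ = H := h2

theorem IsMoorePenroseInverse.transpose {ι κ : Type*} [Fintype ι] [Fintype κ]
    {A : Matrix ι κ ℝ} {G : Matrix κ ι ℝ} (h : IsMoorePenroseInverse A G) :
    IsMoorePenroseInverse Aᵀ Gᵀ := by
  obtain ⟨h1, h2, h3, h4⟩ := h
  refine ⟨?_, ?_, ?_, ?_⟩
  · rw [Matrix.mul_assoc, ← Matrix.transpose_mul, ← Matrix.transpose_mul, h1]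
  · rw [Matrix.mul_assoc, ← Matrix.transpose_mul, ← Matrix.transpose_mul, h2]
  · rw [← Matrix.transpose_mul, h4, h4]
  · rw [← Matrix.transpose_mul, h3, h3]

/-! ### Schur complement estimate -/

/-- If `G` is the Moore-Penrose inverse of a positive semidefinite `M` and `W` agrees with `M` on
the range of `M`, then `0 ≤ K G Kᵀ ≤ L` for every positive semidefinite block matrix
`[W, Kᵀ; K, L]`. -/
theorem posSemidef_mul_pinv_mul_transpose {ι κ : Type*} [Fintype ι] [DecidableEq ι] [Fintype κ]
    {W M G : Matrix κ κ ℝ} {K : Matrix ι κ ℝ} {L : Matrix ι ι ℝ} (hM : M.PosSemidef)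
    (hWM : W * M = M * M) (hG : IsMoorePenroseInverse M G)
    (hB : (Matrix.fromBlocks W Kᵀ K L).PosSemidef) :
    (K * G * Kᵀ).PosSemidef ∧ (L - K * G * Kᵀ).PosSemidef := by
  have hMt : Mᵀ = M := by
    rw [← Matrix.conjTranspose_eq_transpose_of_trivial]; exact hM.isHermitian
  have hGt : Gᵀ = G := by
    have := hG.transpose
    rw [hMt] at this
    exact this.unique hG
  have hcomm : G * M = M * G := by
    have := hG.2.2.2
    rwa [Matrix.transpose_mul, hMt, hGt, eq_comm] at this
  have hWG : W * G = M * G := by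
    calc W * G = W * (G * M * G) := by rw [hG.2.1]
      _ = (W * M) * G * G := by rw [hcomm]; simp only [Matrix.mul_assoc]
      _ = M * (M * G) * G := by rw [hWM]; simp only [Matrix.mul_assoc]
      _ = M * (G * M * G) := by rw [← hcomm]; simp only [Matrix.mul_assoc]
      _ = M * G := by rw [hG.2.1]
  have hGWG : G * W * G = G := by rw [Matrix.mul_assoc, hWG, ← Matrix.mul_assoc, hG.2.1]
  constructor
  · have := hM.mul_mul_conjTranspose_same (K * G)
    convert this using 1
    rw [Matrix.conjTranspose_eq_transpose_of_trivial, Matrix.transpose_mul, hGt]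
    nth_rewrite 1 [← hG.2.1]
    simp only [Matrix.mul_assoc]
  -- Congruence by `[-KG, 1]` gives `L - 2 K G Kᵀ + K (G W G) Kᵀ`, and `G W G = G`.
  · have := hB.mul_mul_conjTranspose_same (Matrix.fromCols (-(K * G)) (1 : Matrix ι ι ℝ))
    convert this using 1
    rw [Matrix.conjTranspose_eq_transpose_of_trivial, Matrix.transpose_fromCols,
      Matrix.fromCols_mul_fromBlocks, Matrix.fromCols_mul_fromRows]
    simp only [Matrix.transpose_neg, Matrix.transpose_mul, hGt, Matrix.transpose_one,
      Matrix.one_mul, Matrix.mul_one, Matrix.neg_mul, Matrix.mul_neg, Matrix.add_mul]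
    have : K * G * W * (G * Kᵀ) = K * G * Kᵀ := by
      calc K * G * W * (G * Kᵀ) = K * (G * W * G) * Kᵀ := by simp only [Matrix.mul_assoc]
        _ = K * G * Kᵀ := by rw [hGWG]
    rw [this, ← Matrix.mul_assoc K G Kᵀ]
    abel

/-! ### Norm bounds -/

theorem matFrobeniusNorm_sub_comm {ι : Type*} [Fintype ι] (A B : Matrix ι ι ℝ) :
    matFrobeniusNorm (A - B) = matFrobeniusNorm (B - A) := by
  simp only [matFrobeniusNorm, Matrix.sub_apply, sub_sq_comm]

theorem matSpectralNorm_le_matFrobeniusNorm {ι : Type*} [Fintype ι] [DecidableEq ι]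
    (A : Matrix ι ι ℝ) : matSpectralNorm A ≤ matFrobeniusNorm A := by
  refine ContinuousLinearMap.opNorm_le_bound _ (Real.sqrt_nonneg _) fun x => ?_
  rw [EuclideanSpace.norm_eq, EuclideanSpace.norm_eq, matFrobeniusNorm,
    ← Real.sqrt_mul (by positivity)]
  refine Real.sqrt_le_sqrt ?_
  rw [Finset.sum_mul]
  refine Finset.sum_le_sum fun i _ => ?_
  simp only [Real.norm_eq_abs, sq_abs]
  rw [Matrix.ofLp_toEuclideanCLM]
  exact Finset.sum_mul_sq_le_sq_mul_sq _ _ _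

/-- Nonnegativity of the 2×2 principal minor; `i = j` is harmless, since `submatrix` allows repeated
indices. -/
theorem Matrix.PosSemidef.sq_apply_le {ι : Type*} [Fintype ι] [DecidableEq ι]
    {A : Matrix ι ι ℝ} (hA : A.PosSemidef) (i j : ι) : A i j ^ 2 ≤ A i i * A j j := by
  have h := (hA.submatrix ![i, j]).det_nonneg
  have hs := hA.isHermitian.apply i j
  rw [star_trivial] at hs
  rw [Matrix.det_fin_two] at h
  simp only [Matrix.submatrix_apply, Matrix.cons_val_zero, Matrix.cons_val_one, hs] at h
  nlinarith

theorem Matrix.PosSemidef.matFrobeniusNorm_le_trace {ι : Type*} [Fintype ι] [DecidableEq ι]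
    {A : Matrix ι ι ℝ} (hA : A.PosSemidef) : matFrobeniusNorm A ≤ A.trace := by
  refine Real.sqrt_le_iff.mpr ⟨hA.trace_nonneg, ?_⟩
  rw [sq, Matrix.trace, Finset.sum_mul_sum]
  exact Finset.sum_le_sum fun i _ => Finset.sum_le_sum fun j _ => hA.sq_apply_le i j

theorem matFrobeniusNorm_le_fromBlocks {ι κ : Type*} [Fintype ι] [Fintype κ]
    (A : Matrix κ κ ℝ) (B : Matrix κ ι ℝ) (C : Matrix ι κ ℝ) (D : Matrix ι ι ℝ) :
    matFrobeniusNorm D ≤ matFrobeniusNorm (Matrix.fromBlocks A B C D) := by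
  refine Real.sqrt_le_sqrt ?_
  simp only [Fintype.sum_sum_type, Matrix.fromBlocks_apply₁₁, Matrix.fromBlocks_apply₁₂,
    Matrix.fromBlocks_apply₂₁, Matrix.fromBlocks_apply₂₂, Finset.sum_add_distrib]
  have : 0 ≤ ∑ i, ∑ j, A i j ^ 2 := by positivity
  have : 0 ≤ ∑ i, ∑ j, B i j ^ 2 := by positivity
  have : 0 ≤ ∑ i, ∑ j, C i j ^ 2 := by positivity
  linarith

/-! ### Singular values of positive semidefinite matrices -/

/-- An eigenvector of `A` for `μ ≥ 0` is an eigenvector of `T* T` for `μ²`, and the squared singular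
values are the eigenvalues of `T* T`. Multiplicities are not matched; only bounds by the extreme
singular values are needed. -/
theorem Matrix.PosSemidef.exists_singularValues_eq {ι : Type*} [Fintype ι] [DecidableEq ι]
    {A : Matrix ι ι ℝ} (hA : A.PosSemidef) (i : ι) :
    ∃ j < Fintype.card ι,
      (Matrix.toEuclideanLin A).singularValues j = hA.isHermitian.eigenvalues i := by
  set T := Matrix.toEuclideanLin A with hT
  set v := hA.isHermitian.eigenvectorBasis i
  set μ := hA.isHermitian.eigenvalues i
  have hTv : T v = μ • v := by
    rw [hT, Matrix.toLpLin_apply, hA.isHermitian.mulVec_eigenvectorBasis i]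
    rfl
  have hadj : LinearMap.adjoint T = T := by
    rw [hT, ← Matrix.toEuclideanLin_conjTranspose_eq_adjoint, hA.isHermitian]
  have hv : v ≠ 0 := (hA.isHermitian.eigenvectorBasis.orthonormal.ne_zero i)
  have hev : Module.End.HasEigenvalue (LinearMap.adjoint T ∘ₗ T) (μ ^ 2) := by
    refine Module.End.hasEigenvalue_of_hasEigenvector (x := v)
      ⟨Module.End.mem_eigenspace_iff.mpr ?_, hv⟩
    rw [hadj, LinearMap.comp_apply, hTv, map_smul, hTv, smul_smul, sq]
  have hfin : Module.finrank ℝ (EuclideanSpace ℝ ι) = Fintype.card ι := finrank_euclideanSpace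
  obtain ⟨j, hj⟩ := T.isSymmetric_adjoint_comp_self.exists_eigenvalues_eq hfin hev
  refine ⟨j, j.2, ?_⟩
  rw [← pow_left_inj₀ (T.singularValues_nonneg j) (hA.eigenvalues_nonneg i) two_ne_zero,
    T.sq_singularValues_fin hfin]
  exact hj

theorem Matrix.PosSemidef.matFrobeniusNorm_le_sqrt_mul {ι : Type*} [Fintype ι] [DecidableEq ι]
    {A : Matrix ι ι ℝ} (hA : A.PosSemidef) :
    matFrobeniusNorm A ≤
      √(Fintype.card ι) * (Matrix.toEuclideanLin A).singularValues 0 := by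
  set s := (Matrix.toEuclideanLin A).singularValues 0
  have hs : 0 ≤ s := LinearMap.singularValues_nonneg _ _
  have hle : ∀ x : EuclideanSpace ℝ ι, ‖Matrix.toEuclideanLin A x‖ ^ 2 ≤ s ^ 2 * ‖x‖ ^ 2 := by
    intro x
    set b := hA.isHermitian.eigenvectorBasis
    have hb : ∀ i, inner ℝ (b i) (Matrix.toEuclideanLin A x) =
        hA.isHermitian.eigenvalues i * inner ℝ (b i) x := by
      intro i
      rw [← LinearMap.adjoint_inner_left, ← Matrix.toEuclideanLin_conjTranspose_eq_adjoint,
        hA.isHermitian, Matrix.toLpLin_apply, hA.isHermitian.mulVec_eigenvectorBasis i]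
      exact real_inner_smul_left _ _ _
    rw [← b.sum_sq_norm_inner_right, ← b.sum_sq_norm_inner_right x, Finset.mul_sum]
    refine Finset.sum_le_sum fun i _ => ?_
    rw [hb, norm_mul, mul_pow]
    obtain ⟨j, -, hj⟩ := hA.exists_singularValues_eq i
    have : hA.isHermitian.eigenvalues i ≤ s :=
      hj ▸ LinearMap.singularValues_antitone _ (Nat.zero_le j)
    rw [Real.norm_of_nonneg (hA.eigenvalues_nonneg i)]
    have := hA.eigenvalues_nonneg i
    gcongr
  refine Real.sqrt_le_iff.mpr ⟨by positivity, ?_⟩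
  rw [mul_pow, Real.sq_sqrt (by positivity), Finset.sum_comm]
  -- Each column is the image of a unit basis vector, so its norm is at most `s`.
  calc ∑ j, ∑ i, A i j ^ 2 ≤ ∑ _j : ι, s ^ 2 := Finset.sum_le_sum fun j _ => by
        have := hle (EuclideanSpace.single j 1)
        rw [EuclideanSpace.norm_sq_eq] at this
        simpa [Matrix.toLpLin_apply] using this
    _ = Fintype.card ι * s ^ 2 := by simp

/-- The mean of the eigenvalues is at most `1`, so some eigenvalue is, and the last singular value
lies below it. -/
theorem Matrix.PosSemidef.singularValues_card_sub_one_le {ι : Type*} [Fintype ι] [DecidableEq ι]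
    [Nonempty ι] {A : Matrix ι ι ℝ} (hA : A.PosSemidef) (htr : A.trace ≤ Fintype.card ι) :
    (Matrix.toEuclideanLin A).singularValues (Fintype.card ι - 1) ≤ 1 := by
  obtain ⟨i, -, hi⟩ : ∃ i ∈ Finset.univ, hA.isHermitian.eigenvalues i ≤ 1 := by
    refine Finset.exists_le_of_sum_le Finset.univ_nonempty ?_
    have := hA.isHermitian.trace_eq_sum_eigenvalues
    simp only [RCLike.ofReal_real_eq_id, id] at this
    rw [← this]
    simpa using htr
  obtain ⟨j, hjlt, hj⟩ := hA.exists_singularValues_eq i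
  rw [← hj] at hi
  exact (LinearMap.singularValues_antitone _ (Nat.le_sub_one_of_lt hjlt)).trans hi

theorem Matrix.PosSemidef.ofReal_singularValues_zero_le_condNumber {ι : Type*} [Fintype ι]
    [DecidableEq ι] [Nonempty ι] {A : Matrix ι ι ℝ} (hA : A.PosSemidef)
    (htr : A.trace ≤ Fintype.card ι) :
    ENNReal.ofReal ((Matrix.toEuclideanLin A).singularValues 0) ≤ condNumber A := by
  rw [condNumber]
  split_ifs with h
  · exact le_top
  · exact ENNReal.ofReal_le_ofReal (le_div_self (LinearMap.singularValues_nonneg _ _)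
      ((LinearMap.singularValues_pos_iff_ne_zero _ _).mpr h)
      (hA.singularValues_card_sub_one_le htr))

/-! ### The error bounds -/

theorem mainTheorem3 (m P nx ny k : ℕ) (n : Fin P → ℕ) (hn : ∑ p, n p = nx)
    (hnx : 2 ≤ nx) (hny : 2 ≤ ny) (hk : k ≤ nx + ny) (γ : ℝ) (hγ : 0 < γ)
    (Xc : (p : Fin P) → Matrix (Fin m) (Fin (n p)) ℝ)
    (X : Matrix (Fin m) ((p : Fin P) × Fin (n p)) ℝ) (hX : X = concatClients Xc)
    (Y E Yt : Matrix (Fin m) (Fin ny) ℝ) (hYt : Yt = Y + E)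
    (Wk Wkd : Matrix (Fin ny) (Fin ny) ℝ)
    (hWk : IsBestRankApprox k (kernelMatrix γ Yt Yt) Wk)
    (hWkd : IsMoorePenroseInverse Wk Wkd) :
    ENNReal.ofReal (matSpectralNorm (nystromEstimate γ X Yt Wkd - kernelMatrix γ X X)) ≤
        condNumber (kernelMatrix γ (Matrix.fromCols Yt X) (Matrix.fromCols Yt X)) *
          ENNReal.ofReal (|mmd γ X Yt| / ((nx : ℝ) + ny) + 1) +
        ENNReal.ofReal (2 * (nx : ℝ)) ∧
    ENNReal.ofReal (matFrobeniusNorm (nystromEstimate γ X Yt Wkd - kernelMatrix γ X X)) ≤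
        ENNReal.ofReal (Real.sqrt ((nx : ℝ) + ny - k)) *
          condNumber (kernelMatrix γ (Matrix.fromCols Yt X) (Matrix.fromCols Yt X)) *
          ENNReal.ofReal (|mmd γ X Yt| / ((nx : ℝ) + ny) + 1) +
        ENNReal.ofReal (2 * (k : ℝ) ^ (1 / 4 : ℝ) * nx * Real.sqrt (1 + (ny : ℝ) / nx)) := by
  subst hX
  set X := concatClients Xc
  have hcard : Fintype.card ((p : Fin P) × Fin (n p)) = nx := by simp [hn]
  have hKa := posSemidef_kernelMatrix hγ.le (Matrix.fromCols Yt X)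
  have htrX : (kernelMatrix γ X X).trace = nx := by rw [trace_kernelMatrix_self, hcard]
  have hblock := kernelMatrix_fromCols γ Yt X
  obtain ⟨hM, hWM⟩ := hWk.posSemidef_and_mul_eq (posSemidef_kernelMatrix hγ.le Yt)
  obtain ⟨hest, hres⟩ := posSemidef_mul_pinv_mul_transpose hM hWM hWkd (hblock ▸ hKa)
  have hfrob : matFrobeniusNorm (nystromEstimate γ X Yt Wkd - kernelMatrix γ X X) ≤ nx := by
    rw [matFrobeniusNorm_sub_comm]
    refine hres.matFrobeniusNorm_le_trace.trans ?_
    rw [Matrix.trace_sub, htrX]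
    exact sub_le_self _ hest.trace_nonneg
  have hnx0 : (0 : ℝ) < nx := by positivity
  constructor
  · refine le_add_left (ENNReal.ofReal_le_ofReal ?_)
    linarith [matSpectralNorm_le_matFrobeniusNorm
      (nystromEstimate γ X Yt Wkd - kernelMatrix γ X X)]
  -- At `k = 0` the factor `k^{1/4}` vanishes, so the additive term is of no help.
  rcases Nat.eq_zero_or_pos k with rfl | hkpos
  · have hWk0 : Wk = 0 := by
      obtain ⟨U, -, V, -, σ, -, -, -, rfl⟩ := hWk
      simp
    have hWkd0 : Wkd = 0 := by rw [← hWkd.2.1, hWk0]; simp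
    have hN : Fintype.card (Fin ny ⊕ ((p : Fin P) × Fin (n p))) = ny + nx := by
      rw [Fintype.card_sum, hcard, Fintype.card_fin]
    have : Nonempty (Fin ny) := ⟨⟨0, by omega⟩⟩
    refine le_add_right ?_
    have hcond := hKa.ofReal_singularValues_zero_le_condNumber (trace_kernelMatrix_self γ _).le
    have hone : 1 ≤ ENNReal.ofReal (|mmd γ X Yt| / ((nx : ℝ) + ny) + 1) := by
      rw [ENNReal.one_le_ofReal]
      exact le_add_of_nonneg_left (by positivity)
    refine le_trans ?_ (le_mul_of_one_le_right zero_le hone)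
    refine le_trans ?_ (mul_le_mul_right hcond _)
    rw [← ENNReal.ofReal_mul (Real.sqrt_nonneg _)]
    refine ENNReal.ofReal_le_ofReal ?_
    have h1 := hKa.matFrobeniusNorm_le_sqrt_mul
    rw [hN] at h1
    rw [matFrobeniusNorm_sub_comm, hWkd0]
    simp only [nystromEstimate, Matrix.mul_zero, Matrix.zero_mul, sub_zero, Nat.cast_zero]
    refine (matFrobeniusNorm_le_fromBlocks (kernelMatrix γ Yt Yt) (kernelMatrix γ X Yt)ᵀ
      (kernelMatrix γ X Yt) _).trans ?_
    rw [← hblock]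
    refine h1.trans_eq ?_
    push_cast
    rw [add_comm]
  · refine le_add_left (ENNReal.ofReal_le_ofReal (hfrob.trans ?_))
    -- For `k ≥ 1` both `k^{1/4}` and the square root are at least `1`, so the additive term alone
    -- exceeds `n_x`.
    have h1 : (1 : ℝ) ≤ (k : ℝ) ^ (1 / 4 : ℝ) :=
      Real.one_le_rpow (by exact_mod_cast hkpos) (by norm_num)
    have h2 : (1 : ℝ) ≤ √(1 + (ny : ℝ) / nx) :=
      Real.one_le_sqrt.mpr (le_add_of_nonneg_right (by positivity))
    have h3 : (nx : ℝ) ≤ 2 * (k : ℝ) ^ (1 / 4 : ℝ) * nx := by nlinarith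
    exact h3.trans (le_mul_of_one_le_right (by positivity) h2)
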